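/- Let $X$ be a real Hilbert space and let $A, B\colon X\rightrightarrows X$ be maximally monotone operators. Put $\operatorname{dom}A=\{x\in X: Ax\neq\varnothing\}$ and $\operatorname{ran}A=\bigcup_{x\in X}Ax$. Let $J_A=(\mathrm{Id}+A)^{-1}$, $R_A=2J_A-\mathrm{Id}$, and let $T=\mathrm{Id}-J_A+J_BR_A$ be the Douglas--Rachford operator of $(A,B)$. Put $D=\operatorname{dom}A-\operatorname{dom}B$ and $R=\operatorname{ran}A+\operatorname{ran}B$, and assume that $$\overline{\operatorname{ran}}(\mathrm{Id}-T)=\overline{D\cap R}=\overline{D}\cap\overline{R}.$$ For a set $C\subseteq X$ let $P_C x$ denote the unique point of $C$ nearest to $x$ (when it exists), let $\operatorname{rec}C=\{d\in X: d+C\subseteq C\}$ and $C^{\oplus}=\{u\in X:\langle c,u\rangle\ge 0\text{ for all }c\in C\}$. Then the vectors $$v=P_{\overline{\operatorname{ran}}(\mathrm{Id}-T)}(0),\qquad v_D=P_{\overline{D}}(0),\qquad v_R=P_{\overline{R}}(0)$$ are well defined, the projections of $v$ below are well defined, and 1. $v_D=P_{(\operatorname{rec}\overline{\operatorname{dom}}A)^{\oplus}}\,v$;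 2. $v_R=P_{-\operatorname{rec}\overline{\operatorname{dom}}A}\,v$; 3. $v_D=P_{-\operatorname{rec}\overline{\operatorname{ran}}A}\,v$; 4. $v_R=P_{(\operatorname{rec}\overline{\operatorname{ran}}A)^{\oplus}}\,v$. -/

import Mathlib

open scoped Pointwise

namespace DRSplit

noncomputable section

/-! Set-valued operators on `X` are functions `X → Set X`; sums, differences and scalar multiples
of such operators are the pointwise Minkowski ones. -/

section Operators

variable {X : Type*}

/-- The domain `{x | A x ≠ ∅}` of a set-valued operator. -/
def dom (A : X → Set X) : Set X := {x | (A x).Nonempty}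

/-- The range `A(X) = ⋃ x, A x` of a set-valued operator. -/
def ran (A : X → Set X) : Set X := ⋃ x, A x

/-- The identity, as a set-valued operator. -/
def idOp : X → Set X := fun x => {x}

/-- The inverse of a set-valued operator: `x ∈ A⁻¹ u` iff `u ∈ A x`. -/
def opInv (A : X → Set X) : X → Set X := fun u => {x | u ∈ A x}

/-- Composition of set-valued operators: `(B ∘ A) x = ⋃ y ∈ A x, B y`. -/
def opComp (B A : X → Set X) : X → Set X := fun x => ⋃ y ∈ A x, B y

end Operators

variable {X : Type*} [NormedAddCommGroup X] [InnerProductSpace ℝ X]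

/-- Monotonicity of a set-valued operator. -/
def IsMonotoneOp (A : X → Set X) : Prop :=
  ∀ x y : X, ∀ u ∈ A x, ∀ w ∈ A y, 0 ≤ inner ℝ (x - y) (u - w)

/-- Maximal monotonicity: `A` is monotone, and every pair `(x, u)` which is monotonically related
to the graph of `A` belongs to that graph. -/
def IsMaximallyMonotone (A : X → Set X) : Prop :=
  IsMonotoneOp A ∧
    ∀ x u : X, (∀ y : X, ∀ w ∈ A y, 0 ≤ inner ℝ (x - y) (u - w)) → u ∈ A x

/-- Maximal monotonicity is maximality of the graph among the monotone operators. -/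
theorem isMaximallyMonotone_iff_maximal (A : X → Set X) :
    IsMaximallyMonotone A ↔ Maximal IsMonotoneOp A := by
  constructor
  · rintro ⟨hm, hmax⟩
    refine ⟨hm, fun B hB hAB x u hu => hmax x u fun y w hw => hB x y u hu w (hAB y hw)⟩
  · rintro ⟨hm, hmax⟩
    refine ⟨hm, fun x u h => ?_⟩
    have key : IsMonotoneOp (fun y => A y ∪ {w | y = x ∧ w = u}) := by
      rintro y z a (ha | ⟨rfl, rfl⟩) b (hb | ⟨rfl, rfl⟩)
      · exact hm y z a ha b hb
      · have := h y a ha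
        rwa [← neg_sub y z, ← neg_sub a b, inner_neg_neg] at this
      · exact h z b hb
      · simp
    exact hmax key (fun y w hw => Or.inl hw) x (Or.inr ⟨rfl, rfl⟩)

/-- The resolvent `J_A = (Id + A)⁻¹`. -/
def resolvent {X : Type*} [AddGroup X] (A : X → Set X) : X → Set X := opInv (idOp + A)

/-- The reflected resolvent `R_A = 2 J_A - Id`. -/
def reflectedResolvent (A : X → Set X) : X → Set X := (2 : ℝ) • resolvent A - idOp

/-- The Douglas--Rachford operator `T = Id - J_A + J_B R_A`. -/
def douglasRachford (A B : X → Set X) : X → Set X :=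
  idOp - resolvent A + opComp (resolvent B) (reflectedResolvent A)

theorem mem_resolvent {X : Type*} [AddCommGroup X]
    {A : X → Set X} {x p : X} : p ∈ resolvent A x ↔ x - p ∈ A p := by
  constructor
  · rintro ⟨a, ha, b, hb, h⟩
    obtain rfl : a = p := ha
    have : x - a = b := by rw [← h]; simp
    rwa [this]
  · intro h
    exact ⟨p, rfl, x - p, h, by simp⟩

/-- The resolvent of a monotone operator is at most single-valued, so that the set-valued
reading of `J_A`, `R_A` and `T` is the usual single-valued one. -/
theorem IsMonotoneOp.resolvent_subsingleton {A : X → Set X} (hA : IsMonotoneOp A) (x : X) :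
    (resolvent A x).Subsingleton := by
  intro p hp q hq
  rw [mem_resolvent] at hp hq
  have h := hA p q _ hp _ hq
  have e : x - p - (x - q) = -(p - q) := by abel
  rw [e, inner_neg_right, real_inner_self_eq_norm_sq] at h
  have h2 : ‖p - q‖ = 0 := by nlinarith [norm_nonneg (p - q)]
  exact sub_eq_zero.mp (norm_eq_zero.mp h2)

/-- `p` is a best approximation to `x` from `C`. -/
def IsBestApprox (C : Set X) (x p : X) : Prop := p ∈ C ∧ ∀ q ∈ C, ‖x - p‖ ≤ ‖x - q‖

/-- The projection of `x` onto `C` is well defined: there is exactly one best approximation. -/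
def HasProj (C : Set X) (x : X) : Prop := ∃! p, IsBestApprox C x p

open Classical in
/-- The projection `P_C x`, that is, the best approximation to `x` from `C`
(meaningful when `HasProj C x`). -/
def proj (C : Set X) (x : X) : X :=
  if h : ∃ p, IsBestApprox C x p then h.choose else 0

/-- The recession cone `rec C = {d | d + C ⊆ C}`. -/
def recCone (C : Set X) : Set X := {d | ∀ c ∈ C, d + c ∈ C}

/-- The dual cone `C^⊕ = {u | ⟨c, u⟩ ≥ 0 for all c ∈ C}`. -/
def dualCone (C : Set X) : Set X := {u | ∀ c ∈ C, 0 ≤ inner ℝ c u}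

/-- `D = dom A - dom B`. -/
def setD (A B : X → Set X) : Set X := dom A - dom B

/-- `R = ran A + ran B`. -/
def setR (A B : X → Set X) : Set X := ran A + ran B

/-- The minimal displacement vector `v`, the projection of `0` onto the closure of
`ran (Id - T)`. -/
def minDisplacement (A B : X → Set X) : X :=
  proj (closure (ran (idOp - douglasRachford A B))) 0

/-- The vector `v_D`, the projection of `0` onto the closure of `D`. -/
def vecD (A B : X → Set X) : X := proj (closure (setD A B)) 0

/-- The vector `v_R`, the projection of `0` onto the closure of `R`. -/
def vecR (A B : X → Set X) : X := proj (closure (setR A B)) 0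

end

end DRSplit

open DRSplit

open Filter Topology

/-! Let `d` and `r` be the projections of 0 onto the closures of `D` and `R`. Their variational
inequalities make each nonnegative on the recession directions of its own set, hence on those
contributed by `A` and `B`. The key fact is that the polar of `rec (closure (dom A))` lies in `rec
(closure (ran A))`, and conversely (`mem_recCone_ran`, `mem_recCone_dom`). It puts `-d` in the
recession cone of `closure (ran A)`, `d` in that of `closure (ran B)`, and `-r` in those of both
closed domains. Hence `d ⟂ r`, and `d + r` lies in both closures. Adding the variational
inequalities gives `v = d + r`, and Moreau's decomposition reads off the four projections.

The key fact rests on Minty's theorem: if `z ∈ A y + ε y`, then `ε y` tends to the displacement of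
`z` from `closure (ran A)` as `ε ↓ 0`, and this limit is a recession direction of the convex set
`closure (dom A)`. -/

namespace DRSplit

/-! ### Projections and minimisation in Hilbert space -/

section Projection

variable {H : Type*} [NormedAddCommGroup H] [InnerProductSpace ℝ H]

/-- A point of `C` satisfying the variational inequality is the unique best approximation. -/
theorem hasProj_and_proj_eq {C : Set H} {x p : H} (hp : p ∈ C)
    (h : ∀ q ∈ C, inner ℝ (x - p) (q - p) ≤ 0) : HasProj C x ∧ proj C x = p := by
  have key : ∀ q ∈ C, ‖x - p‖ ^ 2 + ‖q - p‖ ^ 2 ≤ ‖x - q‖ ^ 2 := by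
    intro q hq
    have e : x - q = (x - p) - (q - p) := by abel
    rw [e, norm_sub_sq_real (x - p) (q - p)]
    linarith [h q hq]
  have hbest : IsBestApprox C x p := by
    refine ⟨hp, fun q hq => ?_⟩
    have := key q hq
    exact le_of_sq_le_sq (by nlinarith [sq_nonneg ‖q - p‖]) (norm_nonneg _)
  have huniq : ∀ q, IsBestApprox C x q → q = p := by
    rintro q ⟨hq, hmin⟩
    have h1 := key q hq
    have h2 : ‖x - q‖ ^ 2 ≤ ‖x - p‖ ^ 2 := pow_le_pow_left₀ (norm_nonneg _) (hmin p hp) 2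
    have h3 : ‖q - p‖ ^ 2 = 0 := le_antisymm (by linarith) (sq_nonneg _)
    exact sub_eq_zero.mp (norm_eq_zero.mp (pow_eq_zero_iff two_ne_zero |>.mp h3))
  refine ⟨⟨p, hbest, huniq⟩, ?_⟩
  have hex : ∃ q, IsBestApprox C x q := ⟨p, hbest⟩
  rw [proj, dif_pos hex]
  exact huniq _ hex.choose_spec

/-- Existence of the projection onto a nonempty closed convex set of a Hilbert space. -/
theorem exists_variational [CompleteSpace H] {C : Set H} (hne : C.Nonempty) (hcl : IsClosed C)
    (hc : Convex ℝ C) (x : H) : ∃ p ∈ C, ∀ q ∈ C, inner ℝ (x - p) (q - p) ≤ 0 := by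
  obtain ⟨p, hp, hmin⟩ := exists_norm_eq_iInf_of_complete_convex hne hcl.isComplete hc x
  exact ⟨p, hp, (norm_eq_iInf_iff_real_inner_le_zero hc hp).1 hmin⟩

/-- A function of the form `½‖z‖² + t` which is bounded below on a nonempty closed convex subset of
`H × ℝ` attains its infimum there; the conclusion is the first-order optimality condition. -/
theorem exists_minimizer_half_sq_add [CompleteSpace H] {E : Set (H × ℝ)} (hne : E.Nonempty)
    (hcl : IsClosed E) (hc : Convex ℝ E) (hb : ∀ e ∈ E, 0 ≤ ‖e.1‖ ^ 2 / 2 + e.2) :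
    ∃ e ∈ E, ∀ f ∈ E, e.2 ≤ f.2 + inner ℝ e.1 (f.1 - e.1) := by
  set g : H × ℝ → ℝ := fun e => ‖e.1‖ ^ 2 / 2 + e.2 with hg
  have hbdd : BddBelow (g '' E) := ⟨0, by rintro _ ⟨e, he, rfl⟩; exact hb e he⟩
  set m := sInf (g '' E) with hm
  have hle : ∀ e ∈ E, m ≤ g e := fun e he => csInf_le hbdd ⟨e, he, rfl⟩
  obtain ⟨u, -, hu, huE⟩ := exists_seq_tendsto_sInf (hne.image g) hbdd
  choose s hsE hs using huE
  have hlim : Tendsto (fun n => g (s n)) atTop (𝓝 m) := by simpa only [hs] using hu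
  -- Parallelogram identity at the midpoint: first components of almost minimal points are close
  -- together.
  have hmid : ∀ a ∈ E, ∀ b ∈ E, ‖a.1 - b.1‖ ^ 2 ≤ 4 * (g a - m) + 4 * (g b - m) := by
    intro a ha b hb
    have h1 := hle _ (hc ha hb (by norm_num : (0 : ℝ) ≤ 1 / 2) (by norm_num : (0 : ℝ) ≤ 1 / 2)
      (by norm_num))
    have h2 : ‖(1 / 2 : ℝ) • a.1 + (1 / 2 : ℝ) • b.1‖ ^ 2 =
        (‖a.1‖ ^ 2 + 2 * inner ℝ a.1 b.1 + ‖b.1‖ ^ 2) / 4 := by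
      rw [← smul_add, norm_smul, mul_pow, norm_add_sq_real]
      norm_num
      ring
    simp only [hg, Prod.fst_add, Prod.snd_add, Prod.smul_fst, Prod.smul_snd, smul_eq_mul] at h1 ⊢
    rw [h2] at h1
    rw [norm_sub_sq_real]
    linarith
  have hcau : CauchySeq (fun n => (s n).1) := by
    rw [Metric.cauchySeq_iff']
    intro ε hε
    have hev : ∀ᶠ n in atTop, g (s n) < m + ε ^ 2 / 8 :=
      hlim.eventually_lt_const (by have := pow_pos hε 2; linarith)
    obtain ⟨N, hN⟩ := eventually_atTop.1 hev
    refine ⟨N, fun n hn => ?_⟩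
    rw [dist_eq_norm]
    have h1 := hmid _ (hsE n) _ (hsE N)
    have h2 := hN n hn
    have h3 := hN N le_rfl
    exact lt_of_pow_lt_pow_left₀ 2 hε.le (by linarith)
  obtain ⟨z, hz⟩ := cauchySeq_tendsto_of_complete hcau
  have ht : Tendsto (fun n => (s n).2) atTop (𝓝 (m - ‖z‖ ^ 2 / 2)) := by
    have h1 : Tendsto (fun n => ‖(s n).1‖ ^ 2 / 2) atTop (𝓝 (‖z‖ ^ 2 / 2)) :=
      (hz.norm.pow 2).div_const 2
    refine (hlim.sub h1).congr fun n => ?_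
    simp only [hg]
    ring
  have hmem : (z, m - ‖z‖ ^ 2 / 2) ∈ E :=
    hcl.mem_of_tendsto (hz.prodMk_nhds ht) (Eventually.of_forall hsE)
  refine ⟨_, hmem, fun f hf => ?_⟩
  set δ := f.2 + inner ℝ z (f.1 - z) - (m - ‖z‖ ^ 2 / 2) with hδ
  -- Minimality along the segment towards `f`, divided by its parameter `l`; the limit `l ↓ 0` gives
  -- `0 ≤ δ`.
  have hquad : ∀ l : ℝ, 0 < l → l ≤ 1 → 0 ≤ δ + l * (‖f.1 - z‖ ^ 2 / 2) := by
    intro l hl hl1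
    have h1 := hle _ (hc hmem hf (by linarith : 0 ≤ 1 - l) hl.le (by ring))
    have e : (1 - l) • z + l • f.1 = z + l • (f.1 - z) := by module
    simp only [hg, Prod.fst_add, Prod.snd_add, Prod.smul_fst, Prod.smul_snd, smul_eq_mul] at h1
    rw [e, norm_add_sq_real, inner_smul_right, norm_smul, mul_pow, Real.norm_eq_abs, sq_abs] at h1
    have h2 : 0 ≤ l * (δ + l * (‖f.1 - z‖ ^ 2 / 2)) := by
      rw [hδ]
      nlinarith
    exact nonneg_of_mul_nonneg_right h2 hl
  have hlim0 : Tendsto (fun l : ℝ => δ + l * (‖f.1 - z‖ ^ 2 / 2)) (𝓝[>] 0) (𝓝 δ) := by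
    have : Continuous fun l : ℝ => δ + l * (‖f.1 - z‖ ^ 2 / 2) := by fun_prop
    simpa using (this.tendsto 0).mono_left nhdsWithin_le_nhds
  have hδ0 : 0 ≤ δ := by
    refine ge_of_tendsto hlim0 ?_
    filter_upwards [Ioc_mem_nhdsGT (zero_lt_one (α := ℝ))] with l hl
    exact hquad l hl.1 hl.2
  simp only
  linarith

end Projection

/-! ### Minty's theorem, closed ranges and domains, recession cones -/

section MaximallyMonotone

variable {X : Type*} [NormedAddCommGroup X] [InnerProductSpace ℝ X] {A : X → Set X}

theorem IsMaximallyMonotone.opInv (hA : IsMaximallyMonotone A) :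
    IsMaximallyMonotone (DRSplit.opInv A) := by
  refine ⟨fun x y u hu w hw => ?_, fun x u h => hA.2 u x fun y w hw => ?_⟩
  · rw [real_inner_comm]
    exact hA.1 u w x hu y hw
  · rw [real_inner_comm]
    exact h w y hw

theorem ran_opInv {X : Type*} (A : X → Set X) : ran (opInv A) = dom A := by
  ext x
  simp [ran, dom, opInv, Set.Nonempty]

theorem dom_opInv {X : Type*} (A : X → Set X) : dom (opInv A) = ran A := by
  ext x
  simp [ran, dom, opInv, Set.Nonempty]

theorem IsMaximallyMonotone.exists_mem (hA : IsMaximallyMonotone A) : ∃ x u, u ∈ A x := by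
  by_contra! h
  exact h 0 0 (hA.2 0 0 fun y w hw => absurd hw (h y w))

theorem IsMaximallyMonotone.dom_nonempty (hA : IsMaximallyMonotone A) : (dom A).Nonempty := by
  obtain ⟨x, u, h⟩ := hA.exists_mem
  exact ⟨x, u, h⟩

theorem IsMaximallyMonotone.ran_nonempty (hA : IsMaximallyMonotone A) : (ran A).Nonempty := by
  obtain ⟨x, u, h⟩ := hA.exists_mem
  exact ⟨u, Set.mem_iUnion.2 ⟨x, h⟩⟩

/-- The basic estimate for solutions of the regularised inclusion `z ∈ A y + ε y`. -/
theorem IsMonotoneOp.regularization_estimate (hA : IsMonotoneOp A) {ε : ℝ}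
    (hε : 0 < ε) {z y x w : X} (hy : z - ε • y ∈ A y) (hw : w ∈ A x) :
    ‖ε • y‖ ^ 2 ≤ inner ℝ (z - w) (ε • y) + ε * inner ℝ (ε • y) x - ε * inner ℝ (z - w) x := by
  have h := mul_nonneg hε.le (hA _ _ _ hy _ hw)
  have e : z - ε • y - w = (z - w) - ε • y := by abel
  have h1 : ε * inner ℝ (y - x) (z - ε • y - w) = inner ℝ (ε • y) ((z - w) - ε • y) -
      ε * inner ℝ x ((z - w) - ε • y) := by
    rw [e, ← real_inner_smul_left, smul_sub, inner_sub_left, real_inner_smul_left x]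
  rw [h1, inner_sub_right, inner_sub_right x, real_inner_self_eq_norm_sq,
    real_inner_comm (z - w) (ε • y), real_inner_comm (z - w) x, real_inner_comm (ε • y) x] at h
  linarith

/-- The solutions `y ε` of `z ∈ A (y ε) + ε • y ε` satisfy `ε • y ε → z - r` as `ε ↓ 0`, where `r` is
the projection of `z` onto the closed convex hull of `ran A`. -/
theorem IsMonotoneOp.tendsto_regularization (hA : IsMonotoneOp A) {z r : X} {y : ℝ → X}
    (hy : ∀ ε, 0 < ε → z - ε • y ε ∈ A (y ε)) (hr : r ∈ closure (convexHull ℝ (ran A)))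
    (hvar : ∀ w ∈ closure (convexHull ℝ (ran A)), inner ℝ (z - r) (w - r) ≤ 0) :
    Tendsto (fun ε => ε • y ε) (𝓝[>] 0) (𝓝 (z - r)) := by
  set G := ‖z - r‖
  -- With `x` and `c` existential and independent of `ε`, the estimate is stable under convex
  -- combinations in `w`, so it passes from `ran A` to its hull.
  have hest : convexHull ℝ (ran A) ⊆ {w | ∃ x c, ∀ ε, 0 < ε →
      ‖ε • y ε‖ ^ 2 ≤ inner ℝ (z - w) (ε • y ε) + ε * inner ℝ (ε • y ε) x + ε * c} := by
    refine convexHull_min ?_ ?_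
    · intro w hw
      obtain ⟨x, hx⟩ := Set.mem_iUnion.1 hw
      refine ⟨x, -inner ℝ (z - w) x, fun ε hε => ?_⟩
      linarith [hA.regularization_estimate hε (hy ε hε) hx]
    · rintro w ⟨x, c, h⟩ w' ⟨x', c', h'⟩ a b ha hb hab
      refine ⟨a • x + b • x', a * c + b * c', fun ε hε => ?_⟩
      have h1 := mul_le_mul_of_nonneg_left (h ε hε) ha
      have h2 := mul_le_mul_of_nonneg_left (h' ε hε) hb
      have e : z - (a • w + b • w') = a • (z - w) + b • (z - w') := by
        rw [smul_sub, smul_sub, sub_add_sub_comm, ← add_smul, hab, one_smul]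
      have h3 : ‖ε • y ε‖ ^ 2 = a * ‖ε • y ε‖ ^ 2 + b * ‖ε • y ε‖ ^ 2 := by
        rw [← add_mul, hab, one_mul]
      rw [e, inner_add_left, inner_add_right, real_inner_smul_left (z - w),
        real_inner_smul_left (z - w'), real_inner_smul_right _ x, real_inner_smul_right _ x']
      linarith
  have hbound : ∀ w ∈ convexHull ℝ (ran A), ∃ x : X, ∃ c : ℝ, ∀ ε, 0 < ε →
      ‖ε • y ε - (z - r)‖ ^ 2 ≤
        (‖r - w‖ + ε * ‖x‖) ^ 2 + 2 * (‖r - w‖ + ε * ‖x‖) * G + 2 * (ε * c) := by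
    intro w hw
    obtain ⟨x, c, h⟩ := hest hw
    refine ⟨x, c, fun ε hε => ?_⟩
    have h1 := h ε hε
    set e := ε • y ε
    have hq : z - e ∈ closure (convexHull ℝ (ran A)) :=
      subset_closure (subset_convexHull ℝ _ (Set.mem_iUnion.2 ⟨_, hy ε hε⟩))
    have h2 := hvar _ hq
    have e1 : z - e - r = (z - r) - e := by abel
    rw [e1, inner_sub_right, real_inner_self_eq_norm_sq] at h2
    have e2 : z - w = (z - r) + (r - w) := by abel
    rw [e2, inner_add_left] at h1
    have h3 := norm_sub_sq_real e (z - r)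
    rw [real_inner_comm] at h3
    have h4 : inner ℝ (r - w) e ≤ ‖r - w‖ * ‖e‖ := real_inner_le_norm _ _
    have h5 : ε * inner ℝ e x ≤ ε * (‖e‖ * ‖x‖) :=
      mul_le_mul_of_nonneg_left (real_inner_le_norm _ _) hε.le
    have h6 : ‖e‖ ≤ ‖e - (z - r)‖ + G := by
      simpa using norm_add_le (e - (z - r)) (z - r)
    have h7 : 0 ≤ ‖r - w‖ + ε * ‖x‖ := by positivity
    have h8 := mul_le_mul_of_nonneg_left h6 h7
    -- With `s = ‖r - w‖ + ε‖x‖` and `t = ‖e - (z - r)‖`, the facts above give `t² ≤ s (t + G) + ε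
    -- c`; then `2 s t ≤ s² + t²` absorbs `t`.
    nlinarith [sq_nonneg (‖e - (z - r)‖ - (‖r - w‖ + ε * ‖x‖))]
  rw [Metric.tendsto_nhds]
  intro η hη
  -- `w` is fixed close to `r` before `ε` tends to 0, since `x` and `c` depend on `w`.
  obtain ⟨w, hw, hwη⟩ : ∃ w ∈ convexHull ℝ (ran A), ‖r - w‖ ^ 2 + 2 * ‖r - w‖ * G < η ^ 2 := by
    have hcont : Continuous fun w => ‖r - w‖ ^ 2 + 2 * ‖r - w‖ * G := by fun_prop
    have hopen : IsOpen {w | ‖r - w‖ ^ 2 + 2 * ‖r - w‖ * G < η ^ 2} :=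
      isOpen_lt hcont continuous_const
    obtain ⟨w, h1, h2⟩ := mem_closure_iff.1 hr _ hopen (by simpa using pow_pos hη 2)
    exact ⟨w, h2, h1⟩
  obtain ⟨x, c, h⟩ := hbound w hw
  have hcont : Continuous fun ε : ℝ =>
      (‖r - w‖ + ε * ‖x‖) ^ 2 + 2 * (‖r - w‖ + ε * ‖x‖) * G + 2 * (ε * c) := by fun_prop
  have hev := (hcont.tendsto 0).eventually_lt_const (u := η ^ 2) (by simpa using hwη)
  filter_upwards [hev.filter_mono nhdsWithin_le_nhds, self_mem_nhdsWithin] with ε h1 h2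
  rw [dist_eq_norm]
  exact lt_of_pow_lt_pow_left₀ 2 hη.le ((h ε h2).trans_lt h1)

variable [CompleteSpace X]

/-- Minty's theorem at the origin: `0 ∈ ran (Id + A)`. The proof minimises the sum of `½‖·‖²` and
the Fitzpatrick function of `A`. -/
theorem IsMaximallyMonotone.exists_neg_mem (hA : IsMaximallyMonotone A) : ∃ p, -p ∈ A p := by
  -- The epigraph of the Fitzpatrick function, with the `L²` norm making `X × X` a Hilbert space.
  let E : Set (WithLp 2 (X × X) × ℝ) :=
    {e | ∀ y, ∀ w ∈ A y, inner ℝ e.1.fst w + inner ℝ y e.1.snd - inner ℝ y w ≤ e.2}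
  have hcl : IsClosed E := by
    have : E = ⋂ y, ⋂ w ∈ A y, {e : WithLp 2 (X × X) × ℝ |
        inner ℝ e.1.fst w + inner ℝ y e.1.snd - inner ℝ y w ≤ e.2} := by
      ext e
      simp [E]
    rw [this]
    exact isClosed_iInter fun y => isClosed_iInter fun w => isClosed_iInter fun _ =>
      isClosed_le (by fun_prop) (by fun_prop)
  have hc : Convex ℝ E := by
    intro e he f hf a b ha hb hab y w hw
    have h1 := mul_le_mul_of_nonneg_left (he y w hw) ha
    have h2 := mul_le_mul_of_nonneg_left (hf y w hw) hb
    simp only [Prod.fst_add, Prod.snd_add, Prod.smul_fst, Prod.smul_snd, WithLp.add_fst,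
      WithLp.add_snd, WithLp.smul_fst, WithLp.smul_snd, inner_add_left, inner_add_right,
      inner_smul_left, inner_smul_right, smul_eq_mul, RCLike.conj_to_real]
    have h3 : inner ℝ y w = a * inner ℝ y w + b * inner ℝ y w := by rw [← add_mul, hab, one_mul]
    linarith
  have hgra : ∀ y, ∀ w ∈ A y, (WithLp.toLp 2 (y, w), inner ℝ y w) ∈ E := by
    intro y w hw y' w' hw'
    have := hA.1 y y' w hw w' hw'
    simp only [inner_sub_left, inner_sub_right] at this
    change inner ℝ y w' + inner ℝ y' w - inner ℝ y' w' ≤ inner ℝ y w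
    linarith
  -- If this failed, the point would be monotonically related to the graph, hence in it by
  -- maximality; testing the epigraph condition at the point itself is then contradictory.
  have hinner : ∀ e ∈ E, inner ℝ e.1.fst e.1.snd ≤ e.2 := by
    intro e he
    by_contra! hlt
    have hmem : e.1.snd ∈ A e.1.fst := by
      refine hA.2 _ _ fun y w hw => ?_
      have := he y w hw
      simp only [inner_sub_left, inner_sub_right]
      linarith
    have := he _ _ hmem
    linarith
  have hb : ∀ e ∈ E, 0 ≤ ‖e.1‖ ^ 2 / 2 + e.2 := by
    intro e he
    have h1 := hinner e he
    have h2 := norm_add_sq_real e.1.fst e.1.snd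
    rw [WithLp.prod_norm_sq_eq_of_L2]
    nlinarith [sq_nonneg ‖e.1.fst + e.1.snd‖]
  obtain ⟨x₀, u₀, h₀⟩ := hA.exists_mem
  obtain ⟨e, he, hmin⟩ := exists_minimizer_half_sq_add ⟨_, hgra x₀ u₀ h₀⟩ hcl hc hb
  have h1 := hinner e he
  set p := e.1.fst
  set q := e.1.snd
  -- Optimality tested at graph points, with `⟨p, q⟩ ≤ e.2`, relates `(-q, -p)` monotonically to `A`
  -- with slack `‖p + q‖²`. Once that pair is in the graph, testing it against itself forces `p + q
  -- = 0`.
  have key : ∀ y, ∀ w ∈ A y, ‖p + q‖ ^ 2 ≤ inner ℝ (-q - y) (-p - w) := by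
    intro y w hw
    have h2 := hmin _ (hgra y w hw)
    simp only [WithLp.prod_inner_apply, inner_sub_right] at h2
    change e.2 ≤ inner ℝ y w +
      (inner ℝ p y + inner ℝ q w - (inner ℝ p p + inner ℝ q q)) at h2
    rw [norm_add_sq_real, ← real_inner_self_eq_norm_sq, ← real_inner_self_eq_norm_sq]
    simp only [inner_sub_left, inner_sub_right, inner_neg_left, inner_neg_right]
    rw [real_inner_comm p q, real_inner_comm p y]
    linarith
  have hmem : -p ∈ A (-q) := hA.2 _ _ fun y w hw => (sq_nonneg _).trans (key y w hw)
  have h0 := key _ _ hmem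
  simp only [sub_self, inner_zero_left] at h0
  have h4 : p + q = 0 := norm_eq_zero.1 (pow_eq_zero_iff two_ne_zero |>.1
    (le_antisymm h0 (sq_nonneg _)))
  rw [← eq_neg_of_add_eq_zero_left h4] at hmem
  exact ⟨p, hmem⟩

/-- Minty's theorem: `A + ε Id` is surjective. -/
theorem IsMaximallyMonotone.exists_add_smul (hA : IsMaximallyMonotone A) {ε : ℝ} (hε : 0 < ε)
    (z : X) : ∃ y, z - ε • y ∈ A y := by
  -- The operator `ε⁻¹ (A - z)`, for which Minty's theorem at the origin is the claim.
  have h : IsMaximallyMonotone fun y => {w | z + ε • w ∈ A y} := by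
    refine ⟨fun x y u hu w hw => ?_, fun x u h => hA.2 _ _ fun y w hw => ?_⟩
    · have := hA.1 x y _ hu _ hw
      rw [add_sub_add_left_eq_sub, ← smul_sub, inner_smul_right] at this
      exact nonneg_of_mul_nonneg_right this hε
    · have e : z + ε • (ε⁻¹ • (w - z)) = w := by
        rw [smul_inv_smul₀ hε.ne']
        abel
      have := h y (ε⁻¹ • (w - z)) (by rwa [Set.mem_ofPred_eq, e])
      have e' : z + ε • u - w = ε • (u - ε⁻¹ • (w - z)) := by
        rw [smul_sub, smul_inv_smul₀ hε.ne']
        abel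
      rw [e', inner_smul_right]
      exact mul_nonneg hε.le this
  obtain ⟨p, hp⟩ := h.exists_neg_mem
  exact ⟨p, by simpa [sub_eq_add_neg] using hp⟩

/-- The range of a maximally monotone operator has a convex closure. -/
theorem IsMaximallyMonotone.closure_ran_eq (hA : IsMaximallyMonotone A) :
    closure (ran A) = closure (convexHull ℝ (ran A)) := by
  refine (closure_mono (subset_convexHull ℝ _)).antisymm fun z hz => ?_
  choose! y hy using fun (ε : ℝ) (hε : 0 < ε) => hA.exists_add_smul hε z
  -- Here `z` is its own projection, so `ε y → 0` and the range points `z - ε y` tend to `z`.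
  have h := hA.1.tendsto_regularization hy hz (by simp)
  rw [sub_self] at h
  refine mem_closure_of_tendsto (by simpa using h.const_sub z) ?_
  filter_upwards [self_mem_nhdsWithin] with ε hε
  exact Set.mem_iUnion.2 ⟨_, hy ε hε⟩

theorem IsMaximallyMonotone.convex_closure_ran (hA : IsMaximallyMonotone A) :
    Convex ℝ (closure (ran A)) := by
  rw [hA.closure_ran_eq]
  exact (convex_convexHull ℝ _).closure

theorem IsMaximallyMonotone.convex_closure_dom (hA : IsMaximallyMonotone A) :
    Convex ℝ (closure (dom A)) := by
  rw [← ran_opInv]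
  exact hA.opInv.convex_closure_ran

/-- The displacement from a point to its projection onto `closure (ran A)` is a recession direction
of `closure (dom A)`. -/
theorem IsMaximallyMonotone.sub_mem_recCone (hA : IsMaximallyMonotone A) {z r : X}
    (hr : r ∈ closure (ran A)) (hvar : ∀ w ∈ closure (ran A), inner ℝ (z - r) (w - r) ≤ 0) :
    z - r ∈ recCone (closure (dom A)) := by
  intro c hc
  choose! y hy using fun (ε : ℝ) (hε : 0 < ε) => hA.exists_add_smul hε z
  rw [hA.closure_ran_eq] at hr hvar
  have h := hA.1.tendsto_regularization hy hr hvar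
  -- Convex combinations of `y ε ∈ dom A` and `c`, with weight `ε` on `y ε`.
  have h1 : Tendsto (fun ε : ℝ => ε • y ε + (1 - ε) • c) (𝓝[>] 0) (𝓝 (z - r + c)) := by
    refine h.add ?_
    have : Continuous fun ε : ℝ => (1 - ε) • c := by fun_prop
    simpa using (this.tendsto 0).mono_left nhdsWithin_le_nhds
  refine isClosed_closure.mem_of_tendsto h1 ?_
  filter_upwards [Ioc_mem_nhdsGT (zero_lt_one (α := ℝ))] with ε hε
  exact hA.convex_closure_dom (subset_closure ⟨_, hy ε hε.1⟩) hc hε.1.le (sub_nonneg.2 hε.2)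
    (by ring)

/-- The polar cone of `rec (closure (dom A))` lies in `rec (closure (ran A))`. -/
theorem IsMaximallyMonotone.mem_recCone_ran (hA : IsMaximallyMonotone A) {d : X}
    (hd : ∀ c ∈ recCone (closure (dom A)), inner ℝ c d ≤ 0) : d ∈ recCone (closure (ran A)) := by
  intro u hu
  -- With `r` the projection of `d + u`, the displacement `d + u - r` is a recession direction of
  -- `closure (dom A)`, so its product with `d` is at most 0. The variational inequality at `u`
  -- bounds its squared norm by that product, so `d + u = r`.
  obtain ⟨r, hr, hvar⟩ := exists_variational hA.ran_nonempty.closure isClosed_closure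
    hA.convex_closure_ran (d + u)
  have h1 := hd _ (hA.sub_mem_recCone hr hvar)
  have h2 := hvar u hu
  have e : u - r = (d + u - r) - d := by abel
  rw [e, inner_sub_right, real_inner_self_eq_norm_sq] at h2
  have h3 : ‖d + u - r‖ ^ 2 = 0 := le_antisymm (by linarith) (sq_nonneg _)
  have h4 : d + u = r := sub_eq_zero.1 (norm_eq_zero.1 (pow_eq_zero_iff two_ne_zero |>.1 h3))
  rwa [h4]

/-- The polar cone of `rec (closure (ran A))` lies in `rec (closure (dom A))`. -/
theorem IsMaximallyMonotone.mem_recCone_dom (hA : IsMaximallyMonotone A) {d : X}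
    (hd : ∀ c ∈ recCone (closure (ran A)), inner ℝ c d ≤ 0) : d ∈ recCone (closure (dom A)) := by
  rw [← ran_opInv]
  exact hA.opInv.mem_recCone_ran (by rwa [dom_opInv])

end MaximallyMonotone

/-! ### Recession cones and convexity of closed sums -/

section RecessionOfSums

variable {X : Type*} [NormedAddCommGroup X]

theorem recCone_subset_recCone_closure_add (S T : Set X) :
    recCone (closure S) ⊆ recCone (closure (S + T)) := by
  intro d hd c hc
  have h : Set.MapsTo (fun x => d + x) (S + T) (closure (S + T)) := by
    rintro _ ⟨s, hs, t, ht, rfl⟩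
    have h1 : d + s ∈ closure S := hd s (subset_closure hs)
    have h2 := map_mem_closure (f := fun x => x + t) (by fun_prop) h1
      (t := S + T) fun s hs => Set.add_mem_add hs ht
    simpa [add_assoc] using h2
  simpa using map_mem_closure (f := fun x => d + x) (by fun_prop) hc h

theorem neg_mem_recCone_closure_neg {S : Set X} {d : X} (hd : d ∈ recCone (closure S)) :
    -d ∈ recCone (closure (-S)) := by
  intro c hc
  rw [← neg_closure] at hc ⊢
  simpa [add_comm] using hd _ hc

variable [InnerProductSpace ℝ X]

theorem convex_closure_add {S T : Set X} (hS : Convex ℝ (closure S)) (hT : Convex ℝ (closure T)) :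
    Convex ℝ (closure (S + T)) := by
  have h : closure (S + T) = closure (closure S + closure T) := by
    refine (closure_mono (Set.add_subset_add subset_closure subset_closure)).antisymm ?_
    refine closure_minimal ?_ isClosed_closure
    rintro _ ⟨s, hs, t, ht, rfl⟩
    exact map_mem_closure₂ continuous_add hs ht fun a ha b hb => Set.add_mem_add ha hb
  rw [h]
  exact (hS.add hT).closure

/-- A point satisfying the variational inequality for `0` over `C` is in the dual cone of `rec C`. -/
theorem inner_nonneg_of_mem_recCone {C : Set X} {p d : X} (hp : p ∈ C)
    (hvar : ∀ q ∈ C, inner ℝ (0 - p) (q - p) ≤ 0) (hd : d ∈ recCone C) : 0 ≤ inner ℝ d p := by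
  have := hvar _ (hd p hp)
  rw [add_sub_cancel_right, zero_sub, inner_neg_left, real_inner_comm] at this
  linarith

end RecessionOfSums

/-! ### Moreau decomposition -/

section Moreau

variable {X : Type*} [NormedAddCommGroup X] [InnerProductSpace ℝ X]

/-- Moreau-type recognition of the projections of `p + q` onto `-K` and `K^⊕`. -/
theorem proj_neg_and_proj_dualCone {K : Set X} {p q : X} (hq : -q ∈ K) (hp : p ∈ dualCone K)
    (hpq : inner ℝ p q = 0) :
    (HasProj (-K) (p + q) ∧ proj (-K) (p + q) = q) ∧
      HasProj (dualCone K) (p + q) ∧ proj (dualCone K) (p + q) = p := by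
  refine ⟨hasProj_and_proj_eq hq fun c hc => ?_, hasProj_and_proj_eq hp fun c hc => ?_⟩
  · have := hp _ hc
    rw [inner_neg_left, real_inner_comm] at this
    rw [add_sub_cancel_right, inner_sub_right, hpq]
    linarith
  · have := hc _ hq
    rw [inner_neg_left] at this
    rw [add_sub_cancel_left, inner_sub_right, real_inner_comm, real_inner_comm p q, hpq] at *
    linarith

end Moreau

end DRSplit

theorem mainTheorem8 {X : Type*} [NormedAddCommGroup X] [InnerProductSpace ℝ X] [CompleteSpace X]
    (A B : X → Set X) (hA : IsMaximallyMonotone A) (hB : IsMaximallyMonotone B)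
    (hT : closure (ran (idOp - douglasRachford A B)) = closure (setD A B ∩ setR A B))
    (hDR : closure (setD A B ∩ setR A B) = closure (setD A B) ∩ closure (setR A B)) :
    -- the vectors `v`, `v_D`, `v_R` are well defined
    (HasProj (closure (ran (idOp - douglasRachford A B))) 0 ∧
      HasProj (closure (setD A B)) 0 ∧
      HasProj (closure (setR A B)) 0) ∧
    -- the projections of `v` onto the four cones are well defined
    (HasProj (dualCone (recCone (closure (dom A)))) (minDisplacement A B) ∧
      HasProj (-recCone (closure (dom A))) (minDisplacement A B) ∧
      HasProj (-recCone (closure (ran A))) (minDisplacement A B) ∧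
      HasProj (dualCone (recCone (closure (ran A)))) (minDisplacement A B)) ∧
    -- the four identities
    vecD A B = proj (dualCone (recCone (closure (dom A)))) (minDisplacement A B) ∧
    vecR A B = proj (-recCone (closure (dom A))) (minDisplacement A B) ∧
    vecD A B = proj (-recCone (closure (ran A))) (minDisplacement A B) ∧
    vecR A B = proj (dualCone (recCone (closure (ran A)))) (minDisplacement A B) := by
  have hD : Convex ℝ (closure (setD A B)) := by
    rw [setD, sub_eq_add_neg]
    refine convex_closure_add hA.convex_closure_dom ?_
    rw [← neg_closure]
    exact hB.convex_closure_dom.neg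
  have hR : Convex ℝ (closure (setR A B)) :=
    convex_closure_add hA.convex_closure_ran hB.convex_closure_ran
  obtain ⟨d, hd, hdvar⟩ := exists_variational (hA.dom_nonempty.sub hB.dom_nonempty).closure
    isClosed_closure hD 0
  obtain ⟨r, hr, hrvar⟩ := exists_variational (hA.ran_nonempty.add hB.ran_nonempty).closure
    isClosed_closure hR 0
  -- recession directions of the summands are recession directions of `D` and `R`
  have hAD : ∀ c ∈ recCone (closure (dom A)), c ∈ recCone (closure (setD A B)) := fun c hc => by
    rw [setD, sub_eq_add_neg]
    exact recCone_subset_recCone_closure_add _ _ hc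
  have hBD : ∀ c ∈ recCone (closure (dom B)), -c ∈ recCone (closure (setD A B)) := fun c hc => by
    rw [setD, sub_eq_add_neg, add_comm]
    exact recCone_subset_recCone_closure_add _ _ (neg_mem_recCone_closure_neg hc)
  have hAR : ∀ c ∈ recCone (closure (ran A)), c ∈ recCone (closure (setR A B)) := fun c hc =>
    recCone_subset_recCone_closure_add _ _ hc
  have hBR : ∀ c ∈ recCone (closure (ran B)), c ∈ recCone (closure (setR A B)) := fun c hc => by
    rw [setR, add_comm]
    exact recCone_subset_recCone_closure_add _ _ hc
  have hdA : d ∈ dualCone (recCone (closure (dom A))) := fun c hc =>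
    inner_nonneg_of_mem_recCone hd hdvar (hAD c hc)
  have hrA : r ∈ dualCone (recCone (closure (ran A))) := fun c hc =>
    inner_nonneg_of_mem_recCone hr hrvar (hAR c hc)
  have hdA' : -d ∈ recCone (closure (ran A)) := hA.mem_recCone_ran fun c hc => by
    simpa [inner_neg_right] using hdA c hc
  have hrA' : -r ∈ recCone (closure (dom A)) := hA.mem_recCone_dom fun c hc => by
    simpa [inner_neg_right] using hrA c hc
  have hdB : d ∈ recCone (closure (ran B)) := hB.mem_recCone_ran fun c hc => by
    simpa [inner_neg_left] using inner_nonneg_of_mem_recCone hd hdvar (hBD c hc)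
  have hrB : -r ∈ recCone (closure (dom B)) := hB.mem_recCone_dom fun c hc => by
    simpa [inner_neg_right] using inner_nonneg_of_mem_recCone hr hrvar (hBR c hc)
  have hrD : r ∈ recCone (closure (setD A B)) := by simpa using hBD _ hrB
  -- The two signs come from different operators: `d` recedes in `closure (ran B)`, while `-r`
  -- recedes in `closure (dom A)`.
  have horth : inner ℝ d r = 0 := by
    refine le_antisymm ?_ (inner_nonneg_of_mem_recCone hr hrvar (hBR d hdB))
    have := hdA _ hrA'
    rw [inner_neg_left, real_inner_comm] at this
    linarith
  have horth' : inner ℝ r d = 0 := by rw [real_inner_comm, horth]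
  obtain ⟨hvproj, hv⟩ : HasProj (closure (ran (idOp - douglasRachford A B))) 0 ∧
      minDisplacement A B = d + r := by
    rw [minDisplacement, hT, hDR]
    refine hasProj_and_proj_eq ⟨?_, hBR d hdB r hr⟩ fun q hq => ?_
    · rw [add_comm]
      exact hrD d hd
    -- By orthogonality the variational inequality for `d + r` is the sum of those for `d` and `r`.
    · have h1 := hdvar q hq.1
      have h2 := hrvar q hq.2
      simp only [zero_sub, inner_neg_left, inner_sub_right, inner_add_left, inner_add_right,
        horth, horth'] at h1 h2 ⊢
      linarith
  obtain ⟨hdproj, hdeq⟩ : HasProj (closure (setD A B)) 0 ∧ vecD A B = d :=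
    hasProj_and_proj_eq hd hdvar
  obtain ⟨hrproj, hreq⟩ : HasProj (closure (setR A B)) 0 ∧ vecR A B = r :=
    hasProj_and_proj_eq hr hrvar
  -- The same splitting `v = d + r` is used twice, with `d` and `r` exchanging roles between the
  -- domain and range cones.
  obtain ⟨⟨h1, h1'⟩, h2, h2'⟩ := proj_neg_and_proj_dualCone hrA' hdA horth
  obtain ⟨⟨h3, h3'⟩, h4, h4'⟩ := proj_neg_and_proj_dualCone hdA' hrA horth'
  rw [add_comm r d] at h3 h3' h4 h4'
  rw [hv, hdeq, hreq]
  exact ⟨⟨hvproj, hdproj, hrproj⟩, ⟨h2, h1, h3, h4⟩, h2'.symm, h1'.symm, h3'.symm, h4'.symm⟩
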